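/- Conventions. Let $E$ be a finite-dimensional Euclidean space and $C\subseteq E$ a closed convex set. A *face* of $C$ is a closed convex subset $F\subseteq C$ such that $y,z\in F$ whenever $y,z\in C$ and some point of the open segment $(y,z)$ lies in $F$; it is *proper* if $F\ne\emptyset$ and $F\neq C$. The set $C$ is *facially exposed* if each of its proper faces is of the form $C\cap H$ with $H$ a supporting hyperplane of $C$. For $x\in C$ the *tangent cone* is $$T(x;C)=\operatorname*{Limsup}_{t\to+\infty}\,t(C-x)=\{\lim_n t_n(y_n-x)\;:\;t_n\to+\infty,\ y_n\in C\}.$$ $C$ is *tangentially exposed* if $T(x;C)\cap\operatorname{span}(F-x)=T(x;F)$ for every face $F\ne C$ of $C$ and every $x\in F$ (if $C$ is a cone, then $\operatorname{span}(F-x)=\operatorname{span}F$). Put $\mathcal T^0(C)=\{C\}$ and $\mathcal T^{k+1}(C)=\{T(x;S): S\in\mathcal T^k(C),\ x\in S\}$; $C$ is *strongly tangentially exposed* if every member of $\mathcal T^k(C)$ is tangentially exposed, for every $k\ge 0$. A closed convex cone $K\subseteq E$ is *facially dual complete* (FDC) if $K^*+F^\perp$ is closed for every proper face $F$ of $K$,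 where $K^*=\{s:\langle s,x\rangle\ge 0\ \ \forall x\in K\}$. Statement. Let $C\subset\mathbb R^3$ be the convex hull of the two arcs $$\{(\cos t,\sin t,1): t\in[0,\pi/2]\}\quad\text{and}\quad\{(\cos t,\sin t,-1): t\in[0,\pi]\},$$ let $K=\operatorname{cone}(C\times\{1\})\subset\mathbb R^4$ be its homogenization, and let $\bar x=(0,1,1)\in C$. Then: 1. $C$ is a closed convex set and $K$ is a closed convex cone; both $C$ and $K$ are facially exposed and tangentially exposed. 2. $K$ is facially dual complete. 3. The tangent cone $T(\bar x;C)$ is neither facially exposed nor tangentially exposed; likewise, the tangent cone $T((\bar x,1);K)$ is neither facially exposed nor tangentially exposed. Consequently, neither $C$ nor $K$ is strongly tangentially exposed. In particular, a closed convex cone in $\mathbb R^4$ that is facially dual complete need not be strongly tangentially exposed: the sufficient condition "strongly tangentially exposed" for facial dual completeness is not necessary. -/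

import Mathlib

open Set Filter Topology
open scoped Pointwise RealInnerProductSpace

noncomputable section

namespace LexTangent

section General

variable {E : Type*} [NormedAddCommGroup E] [InnerProductSpace ℝ E]

/-- `F ⊴ C`: a closed convex subset `F` of `C` such that whenever a point of `F` lies in an open
segment with endpoints in `C`, both endpoints are in `F`. The empty set and `C` are allowed. -/
structure IsFace (C F : Set E) : Prop where
  isClosed : IsClosed F
  convex : Convex ℝ F
  isExtreme : IsExtreme ℝ C F

/-- A proper face: a nonempty face different from the whole set. -/
def IsProperFace (C F : Set E) : Prop :=
  IsFace C F ∧ F.Nonempty ∧ F ≠ C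

/-- Every proper face is exposed, i.e. cut out by a supporting hyperplane (for a nonempty `F ≠ C`
the functional provided by `IsExposed` is nonzero). -/
def FaciallyExposed (C : Set E) : Prop :=
  ∀ F : Set E, IsProperFace C F → IsExposed ℝ C F

/-- The tangent cone `Limsup_{t → +∞} t (C - x)`, as Mathlib's positive tangent cone; see
`mem_tangentCone_iff` for the description as an outer limit. -/
def tangentCone (C : Set E) (x : E) : Set E :=
  posTangentConeAt C x

/-- For `x ∈ C`, the vector `v` is tangent to `C` at `x` iff it is a limit of points
`tₙ (yₙ - x)` with `tₙ → +∞` and `yₙ ∈ C`. -/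
theorem mem_tangentCone_iff {C : Set E} {x : E} (hx : x ∈ C) (v : E) :
    v ∈ tangentCone C x ↔ ∃ (t : ℕ → ℝ) (y : ℕ → E), Tendsto t atTop atTop ∧ (∀ n, y n ∈ C) ∧
      Tendsto (fun n => t n • (y n - x)) atTop (𝓝 v) := by
  constructor
  · intro h
    by_cases hv : v = 0
    · subst hv
      exact ⟨fun n => n, fun _ => x, tendsto_natCast_atTop_atTop, fun _ => hx, by simp⟩
    · have hv' : 0 < ‖v‖ := norm_pos_iff.2 hv
      obtain ⟨α, l, hl, c, d, hd, hC, hcd⟩ := exists_fun_of_mem_tangentConeAt h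
      have key : ∀ n : ℕ, ∃ a : α, (n : ℝ) ≤ (c a : ℝ) ∧ x + d a ∈ C ∧
          dist ((c a : ℝ) • d a) v ≤ 1 / ((n : ℝ) + 1) := by
        intro n
        have hn : (0 : ℝ) < (n : ℝ) + 1 := by positivity
        have e1 : ∀ᶠ a in l, ‖d a‖ < ‖v‖ / (2 * ((n : ℝ) + 1)) := by
          have := hd.norm
          rw [norm_zero] at this
          exact this.eventually (gt_mem_nhds (by positivity))
        have e2 : ∀ᶠ a in l, ‖v‖ / 2 < ‖c a • d a‖ :=
          hcd.norm.eventually (lt_mem_nhds (by linarith))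
        have e3 : ∀ᶠ a in l, dist (c a • d a) v < 1 / ((n : ℝ) + 1) :=
          hcd.eventually (Metric.ball_mem_nhds v (by positivity))
        obtain ⟨a, h1, h2, h3, h4⟩ := (e1.and (e2.and (e3.and hC))).exists
        refine ⟨a, ?_, h4, h3.le⟩
        rw [NNReal.smul_def, norm_smul, Real.norm_of_nonneg (c a).coe_nonneg] at h2
        rw [lt_div_iff₀ (by positivity)] at h1
        by_contra! hlt
        have h5 : (c a : ℝ) * ‖d a‖ ≤ n * ‖d a‖ :=
          mul_le_mul_of_nonneg_right hlt.le (norm_nonneg _)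
        have h6 := norm_nonneg (d a)
        nlinarith
      choose a h1 h2 h3 using key
      refine ⟨fun n => c (a n), fun n => x + d (a n),
        tendsto_atTop_mono h1 tendsto_natCast_atTop_atTop, h2, ?_⟩
      simp only [add_sub_cancel_left]
      exact tendsto_iff_dist_tendsto_zero.2
        (squeeze_zero (fun _ => dist_nonneg) h3 tendsto_one_div_add_atTop_nhds_zero_nat)
  · rintro ⟨t, y, ht, hy, hlim⟩
    have hd : Tendsto (fun n => y n - x) atTop (𝓝 0) := by
      have := (tendsto_inv_atTop_zero.comp ht).smul hlim
      rw [zero_smul] at this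
      refine this.congr' ?_
      filter_upwards [ht.eventually (eventually_gt_atTop 0)] with n hn
      simp [smul_smul, inv_mul_cancel₀ hn.ne']
    refine mem_tangentConeAt_of_seq atTop (fun n => (t n).toNNReal) (fun n => y n - x) hd
      (Eventually.of_forall fun n => by simpa using hy n) (hlim.congr' ?_)
    filter_upwards [ht.eventually (eventually_gt_atTop 0)] with n hn
    rw [NNReal.smul_def, Real.coe_toNNReal _ hn.le]

/-- `T(x; C) ∩ lin (F - x) = T(x; F)` for all faces `F ≠ C` of `C` and all `x ∈ F`. Here
`vectorSpan ℝ F` is the linear span of `F - x` for any `x ∈ F`; for a nonempty face of a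
convex cone it is the linear span of `F`, see `IsFace.vectorSpan_eq_span`. -/
def TangentiallyExposed (C : Set E) : Prop :=
  ∀ F : Set E, IsFace C F → F ≠ C → ∀ x ∈ F,
    tangentCone C x ∩ (vectorSpan ℝ F : Set E) = tangentCone F x

theorem IsFace.vectorSpan_eq_span {K : PointedCone ℝ E} {F : Set E} (hF : IsFace (K : Set E) F)
    (hne : F.Nonempty) : vectorSpan ℝ F = Submodule.span ℝ F := by
  obtain ⟨x, hx⟩ := hne
  have hxK : x ∈ K := hF.isExtreme.subset hx
  have h2 : (2 : ℝ) • x ∈ (K : Set E) := K.smul_mem zero_le_two hxK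
  have h0 : (0 : E) ∈ F := by
    refine hF.isExtreme.left_mem_of_mem_openSegment K.zero_mem h2 hx ?_
    exact ⟨1 / 2, 1 / 2, by norm_num, by norm_num, by norm_num, by simp [smul_smul]⟩
  rw [vectorSpan_eq_span_vsub_set_right ℝ h0]
  simp

/-- The set `𝒯ᵏ(C)` of all lexicographic tangent cones of order `k` of `C`: `𝒯⁰(C) = {C}`, and
`𝒯ᵏ⁺¹(C)` consists of the tangent cones of the members of `𝒯ᵏ(C)` at their points. -/
def lexTangentCones (C : Set E) : ℕ → Set (Set E)
  | 0 => {C}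
  | k + 1 => {S | ∃ T ∈ lexTangentCones C k, ∃ x ∈ T, S = tangentCone T x}

/-- `C` and all of its lexicographic tangent cones are tangentially exposed. -/
def StronglyTangentiallyExposed (C : Set E) : Prop :=
  ∀ k : ℕ, ∀ T ∈ lexTangentCones C k, TangentiallyExposed T

/-- `K* + F^⊥` is closed for every proper face `F` of `K`. The dual space is identified with `E`
through the inner product, so that `K* = {s | ∀ x ∈ K, 0 ≤ ⟪x, s⟫}`. -/
def FaciallyDualComplete [CompleteSpace E] (K : Set E) : Prop :=
  ∀ F : Set E, IsProperFace K F →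
    IsClosed ((ProperCone.innerDual K : Set E) + ((Submodule.span ℝ F)ᗮ : Set E))

end General

/-- The arc `(cos t, sin t, 1)`, `t ∈ [0, π/2]`. -/
def arcTop : Set (EuclideanSpace ℝ (Fin 3)) :=
  (fun t : ℝ => !₂[Real.cos t, Real.sin t, 1]) '' Icc 0 (Real.pi / 2)

/-- The arc `(cos t, sin t, -1)`, `t ∈ [0, π]`. -/
def arcBottom : Set (EuclideanSpace ℝ (Fin 3)) :=
  (fun t : ℝ => !₂[Real.cos t, Real.sin t, -1]) '' Icc 0 Real.pi

/-- The convex hull of the two arcs. -/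
def bodyC : Set (EuclideanSpace ℝ (Fin 3)) :=
  convexHull ℝ (arcTop ∪ arcBottom)

/-- The embedding `x ↦ (x, 1)` of `ℝ³` into `ℝ⁴`. -/
def homLift (x : EuclideanSpace ℝ (Fin 3)) : EuclideanSpace ℝ (Fin 4) :=
  !₂[x 0, x 1, x 2, 1]

/-- The homogenization `cone (C × {1})` of `C`. -/
def coneK : PointedCone ℝ (EuclideanSpace ℝ (Fin 4)) :=
  PointedCone.hull ℝ (homLift '' bodyC)

/-- The point `(0, 1, 1)`. -/
def xBar : EuclideanSpace ℝ (Fin 3) :=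
  !₂[0, 1, 1]

end LexTangent

end

/-!
The positive assertions all follow from one property, `FaceExtension`: every affine function that
is nonnegative on a face `F` of `C` agrees on `F` with an affine function that is nonnegative on
`C`. For a cone it says that `K* + F^⊥` is the dual cone of `F`, which is closed
(`FaceExtension.faciallyDualComplete`). By separation it gives tangential exposedness
(`FaceExtension.tangentiallyExposed`), and by descent on the dimension it gives facial exposedness
(`FaceExtension.faciallyExposed`).

An affine function on `ℝ³`, restricted to the two arcs, is a pair of trigonometric polynomials
`a cos + b sin + c₁` on `[0, π/2]` and `a cos + b sin + c₂` on `[0, π]` with independent constants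
`c₁` and `c₂`. A face is determined by its points on the arcs. Since a nonzero polynomial of this
kind that is nonnegative on an arc has at most one zero there, unless both endpoints are its zeros,
the proper faces are so few that the extension can be written down for each: at most one point on
each arc, a chord of an arc with at most one further vertex, or one of the two horizontal pieces
(`exists_arcNonneg_extension`). The property then passes to the homogenization, because affine
functions on `ℝ³` are linear functions on `ℝ⁴` (`faceExtension_coneK`).

At `(0, 1, 1)` the tangent cone has the face `y = 0`, a quadrant spanned by the directions
`(1, 0, 0)` of the top arc and `(0, 0, -1)` of the vertical edge. The bottom arc continues to the
other side of `x = 0` and touches the plane of this face, so that `(-1, 0, 0)` is tangent to the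
tangent cone at `(0, 0, -2)` but not to the quadrant, and the ray through `(0, 0, -2)` is a face
that is not exposed. The criterion `not_exposed_tangentCone_of_arcs` formulates this for both `C`
and its homogenization.
-/

noncomputable section

namespace LexTangent

section Convexity

variable {E : Type*} [NormedAddCommGroup E] [InnerProductSpace ℝ E]

/-! ### Supporting functionals of extreme subsets -/

/-- An extreme subset `F ≠ C` cannot meet the interior of `C`, so that the Hahn-Banach theorem
separates the two; the separating functional is constant on `F`. -/
theorem exists_support_of_interior {C F : Set E} (hC : Convex ℝ C) (hint : (interior C).Nonempty)
    (hF : Convex ℝ F) (hex : IsExtreme ℝ C F) (hne : F ≠ C) :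
    ∃ (f : StrongDual ℝ E) (c : ℝ), (∀ y ∈ C, c ≤ f y) ∧ (∀ y ∈ F, f y = c) ∧
      ∃ y ∈ C, c < f y := by
  have hdisj : Disjoint (interior C) F := by
    rw [Set.disjoint_left]
    intro p hp hpF
    refine hne (hex.subset.antisymm fun y hy => ?_)
    -- prolong the segment from `y` to the interior point `p` a little beyond `p`
    have hcont : Tendsto (fun ε : ℝ => p + ε • (p - y)) (𝓝[>] 0) (𝓝 p) := by
      have : Continuous fun ε : ℝ => p + ε • (p - y) := by fun_prop
      simpa using (this.tendsto 0).mono_left nhdsWithin_le_nhds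
    obtain ⟨ε, hε, hε0⟩ := ((hcont.eventually (mem_interior_iff_mem_nhds.1 hp)).and
      self_mem_nhdsWithin).exists
    have hε0' : (0 : ℝ) < ε := hε0
    refine hex.left_mem_of_mem_openSegment hy hε hpF
      ⟨ε / (1 + ε), 1 / (1 + ε), by positivity, by positivity, by field_simp; ring, ?_⟩
    have h1 : (1 + ε) ≠ 0 := by positivity
    have : (ε / (1 + ε)) • y + (1 / (1 + ε)) • (p + ε • (p - y))
        = ((1 / (1 + ε)) * (1 + ε)) • p := by module
    rw [this, one_div_mul_cancel h1, one_smul]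
  obtain ⟨f, u, h1, h2⟩ := geometric_hahn_banach_open hC.interior isOpen_interior hF hdisj
  have h3 : ∀ y ∈ C, f y ≤ u := by
    intro y hy
    have hy' : y ∈ closure (interior C) := by
      rw [hC.closure_interior_eq_closure_of_nonempty_interior hint]
      exact subset_closure hy
    exact closure_minimal (t := {y | f y ≤ u}) (fun z hz => (h1 z hz).le)
      (isClosed_le f.continuous continuous_const) hy'
  obtain ⟨p, hp⟩ := hint
  refine ⟨-f, -u, fun y hy => ?_, fun y hy => ?_, p, interior_subset hp, ?_⟩
  · simpa using h3 y hy
  · simpa using le_antisymm (h3 y (hex.subset hy)) (h2 y hy)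
  · simpa using h1 p hp

/-- A convex extreme subset `F ≠ C` of a convex set `C` lies in a supporting hyperplane that does
not contain `C`. The general case reduces to `exists_support_of_interior` by working in the
direction of the affine span of `C`, where `C` has interior points. -/
theorem exists_support [FiniteDimensional ℝ E] {C F : Set E} (hC : Convex ℝ C)
    (hF : Convex ℝ F) (hex : IsExtreme ℝ C F) (hF0 : F.Nonempty) (hne : F ≠ C) :
    ∃ (f : StrongDual ℝ E) (c : ℝ), (∀ y ∈ C, c ≤ f y) ∧ (∀ y ∈ F, f y = c) ∧
      ∃ y ∈ C, c < f y := by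
  obtain ⟨x, hx⟩ := hF0
  have hxC := hex.subset hx
  set V : Submodule ℝ E := vectorSpan ℝ C with hV
  let φ : V →ᵃ[ℝ] E := V.subtype.toAffineMap + AffineMap.const ℝ V x
  have hφ : ∀ v : V, φ v = (v : E) + x := fun v => rfl
  have hlift : ∀ y ∈ C, ∃ v : V, φ v = y := fun y hy =>
    ⟨⟨y - x, vsub_mem_vectorSpan ℝ hy hxC⟩, by simp [hφ]⟩
  have himg : φ '' (φ ⁻¹' C) = C := image_preimage_eq_of_subset fun y hy => by
    obtain ⟨v, hv⟩ := hlift y hy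
    exact ⟨v, hv⟩
  have hspan : vectorSpan ℝ (φ ⁻¹' C) = ⊤ := by
    have h1 : (vectorSpan ℝ (φ ⁻¹' C)).map φ.linear = V := by
      rw [AffineMap.map_vectorSpan, himg]
    have hlin : φ.linear = V.subtype := by ext; simp [φ]
    rw [hlin] at h1
    apply Submodule.map_injective_of_injective V.injective_subtype
    rw [h1, Submodule.map_top, Submodule.range_subtype]
  have h0 : (0 : V) ∈ φ ⁻¹' C := by simpa [hφ] using hxC
  have hint : (interior (φ ⁻¹' C)).Nonempty := by
    rw [(hC.affine_preimage φ).interior_nonempty_iff_affineSpan_eq_top]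
    exact (AffineSubspace.affineSpan_eq_top_iff_vectorSpan_eq_top_of_nonempty ℝ V V ⟨0, h0⟩).2 hspan
  have hex' : IsExtreme ℝ (φ ⁻¹' C) (φ ⁻¹' F) := by
    refine ⟨preimage_mono hex.subset, fun y hy z hz w hw hwy => ?_⟩
    refine hex.left_mem_of_mem_openSegment (x := φ y) hy hz hw ?_
    rw [← image_openSegment]
    exact mem_image_of_mem _ hwy
  have hne' : φ ⁻¹' F ≠ φ ⁻¹' C := by
    intro h
    refine hne (hex.subset.antisymm fun y hy => ?_)
    obtain ⟨v, rfl⟩ := hlift y hy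
    have : v ∈ φ ⁻¹' C := hy
    rw [← h] at this
    exact this
  obtain ⟨f, c, h1, h2, v, hv, hcv⟩ := exists_support_of_interior (hC.affine_preimage φ) hint
    (hF.affine_preimage φ) hex' hne'
  let g : StrongDual ℝ E := f.comp V.orthogonalProjectionOnto
  have hg : ∀ v : V, g (φ v) = f v + g x := by
    intro v
    rw [hφ, map_add]
    simp [g]
  refine ⟨g, c + g x, fun y hy => ?_, fun y hy => ?_, φ v, hv, ?_⟩
  · obtain ⟨v, rfl⟩ := hlift y hy
    rw [hg]
    have := h1 v hy
    linarith
  · obtain ⟨v, rfl⟩ := hlift y (hex.subset hy)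
    rw [hg, h2 v hy]
  · rw [hg]
    linarith

/-! ### Tangent cones of convex sets -/

theorem isClosed_tangentCone (C : Set E) (x : E) : IsClosed (tangentCone C x) := by
  unfold tangentCone
  rw [posTangentConeAt, tangentConeAt_def]
  exact isClosed_setOfPred_clusterPt

theorem tangentCone_mono {C D : Set E} (h : C ⊆ D) (x : E) : tangentCone C x ⊆ tangentCone D x :=
  tangentConeAt_mono h

theorem smul_sub_mem_tangentCone {C : Set E} (hC : Convex ℝ C) {x y : E} (hx : x ∈ C) (hy : y ∈ C)
    {t : ℝ} (ht : 0 ≤ t) : t • (y - x) ∈ tangentCone C x := by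
  rw [mem_tangentCone_iff hx]
  refine ⟨fun n => n + t, fun n => x + (t / (n + t)) • (y - x),
    tendsto_atTop_add_const_right _ _ tendsto_natCast_atTop_atTop, fun n => ?_, ?_⟩
  · refine hC.add_smul_sub_mem hx hy ⟨by positivity, div_le_one_of_le₀ (by simp) (by positivity)⟩
  · refine tendsto_const_nhds.congr' ?_
    filter_upwards [eventually_gt_atTop 0] with n hn
    have : (0 : ℝ) < n + t := by positivity
    rw [add_sub_cancel_left, smul_smul, mul_div_cancel₀ _ this.ne']

theorem sub_mem_tangentCone {C : Set E} (hC : Convex ℝ C) {x y : E} (hx : x ∈ C) (hy : y ∈ C) :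
    y - x ∈ tangentCone C x := by
  simpa using smul_sub_mem_tangentCone hC hx hy zero_le_one

theorem nonneg_of_mem_tangentCone {C : Set E} {x v : E} (hx : x ∈ C) (hv : v ∈ tangentCone C x)
    (f : StrongDual ℝ E) (hf : ∀ y ∈ C, 0 ≤ f (y - x)) : 0 ≤ f v := by
  obtain ⟨t, y, ht, hy, hlim⟩ := (mem_tangentCone_iff hx v).1 hv
  refine ge_of_tendsto ((f.continuous.tendsto v).comp hlim) ?_
  filter_upwards [ht.eventually (eventually_ge_atTop 0)] with n hn
  simpa using mul_nonneg hn (by simpa using hf (y n) (hy n))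

theorem tangentCone_subset_vectorSpan [FiniteDimensional ℝ E] {C : Set E} {x : E} (hx : x ∈ C) :
    tangentCone C x ⊆ vectorSpan ℝ C := by
  intro v hv
  obtain ⟨t, y, ht, hy, hlim⟩ := (mem_tangentCone_iff hx v).1 hv
  exact (Submodule.closed_of_finiteDimensional (vectorSpan ℝ C)).mem_of_tendsto hlim
    (Eventually.of_forall fun n =>
      Submodule.smul_mem _ _ (vsub_mem_vectorSpan ℝ (hy n) hx))

theorem convex_tangentCone {C : Set E} (hC : Convex ℝ C) {x : E} (hx : x ∈ C) :
    Convex ℝ (tangentCone C x) := by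
  have hconv : Convex ℝ {v | ∃ t : ℝ, 0 ≤ t ∧ ∃ y ∈ C, v = t • (y - x)} := by
    rintro _ ⟨t, ht, y, hy, rfl⟩ _ ⟨s, hs, z, hz, rfl⟩ a b ha hb -
    have h1 : 0 ≤ a * t := mul_nonneg ha ht
    have h2 : 0 ≤ b * s := mul_nonneg hb hs
    rcases (add_nonneg h1 h2).eq_or_lt with h | h
    · refine ⟨0, le_rfl, x, hx, ?_⟩
      have h3 : a * t = 0 := by linarith
      have h4 : b * s = 0 := by linarith
      rw [smul_smul, smul_smul, h3, h4]
      simp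
    · refine ⟨a * t + b * s, h.le, _, hC hy hz (div_nonneg h1 h.le) (div_nonneg h2 h.le)
        (by rw [← add_div, div_self h.ne']), ?_⟩
      rw [smul_sub (a * t + b * s), smul_add, smul_smul (a * t + b * s),
        smul_smul (a * t + b * s), mul_div_cancel₀ _ h.ne', mul_div_cancel₀ _ h.ne']
      module
  suffices h : tangentCone C x = closure {v | ∃ t : ℝ, 0 ≤ t ∧ ∃ y ∈ C, v = t • (y - x)} by
    rw [h]
    exact hconv.closure
  apply Subset.antisymm
  · intro v hv
    obtain ⟨t, y, ht, hy, hlim⟩ := (mem_tangentCone_iff hx v).1 hv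
    refine mem_closure_of_tendsto hlim ?_
    filter_upwards [ht.eventually (eventually_ge_atTop 0)] with n hn
    exact ⟨t n, hn, y n, hy n, rfl⟩
  · refine closure_minimal ?_ (isClosed_tangentCone C x)
    rintro _ ⟨t, ht, y, hy, rfl⟩
    exact smul_sub_mem_tangentCone hC hx hy ht

theorem exists_support_of_notMem_tangentCone {C : Set E} (hC : Convex ℝ C) {x v : E} (hx : x ∈ C)
    (hv : v ∉ tangentCone C x) : ∃ f : StrongDual ℝ E, (∀ y ∈ C, f x ≤ f y) ∧ f v < 0 := by
  obtain ⟨f, u, h1, h2⟩ := geometric_hahn_banach_closed_point (convex_tangentCone hC hx)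
    (isClosed_tangentCone C x) hv
  refine ⟨-f, fun y hy => ?_, ?_⟩
  · by_contra! h
    have h3 : 0 < f (y - x) := by
      rw [map_sub]
      simpa using h
    have h4 : 0 < u := by simpa using h1 0 (by simpa using sub_mem_tangentCone hC hx hx)
    have h5 := h1 _ (smul_sub_mem_tangentCone hC hx hy (div_nonneg h4.le h3.le))
    rw [map_smul, smul_eq_mul, div_mul_cancel₀ _ h3.ne'] at h5
    exact lt_irrefl _ h5
  · have h4 : 0 < u := by simpa using h1 0 (by simpa using sub_mem_tangentCone hC hx hx)
    simpa using h4.trans h2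

/-! ### The extension property -/

/-- Every continuous affine function that is nonnegative on a face `F` of `C` agrees on `F` with
one that is nonnegative on `C`. The affine functions are written `y ↦ f y - c` with `f` a
continuous linear functional. -/
def FaceExtension (C : Set E) : Prop :=
  ∀ F : Set E, IsFace C F → ∀ (f : StrongDual ℝ E) (c : ℝ), (∀ y ∈ F, c ≤ f y) →
    ∃ (g : StrongDual ℝ E) (d : ℝ), (∀ y ∈ C, d ≤ g y) ∧ ∀ y ∈ F, g y - d = f y - c

/-- A supporting halfspace of a face `F` at `x` extends to one of `C` that has the same trace on
the span of `F - x`, and the tangent cone of `F` is the intersection of such halfspaces. -/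
theorem FaceExtension.tangentiallyExposed [FiniteDimensional ℝ E] {C : Set E}
    (h : FaceExtension C) : TangentiallyExposed C := by
  intro F hF _ x hx
  have hxC := hF.isExtreme.subset hx
  refine Subset.antisymm ?_ (subset_inter (tangentCone_mono hF.isExtreme.subset x)
    (tangentCone_subset_vectorSpan hx))
  rintro v ⟨hvT, hvs⟩
  by_contra hv
  obtain ⟨f, hf, hfv⟩ := exists_support_of_notMem_tangentCone hF.convex hx hv
  obtain ⟨g, d, hg, hgf⟩ := h F hF f (f x) hf
  have hgx : g x = d := by
    have := hgf x hx
    linarith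
  have hgv : (g - f) v = 0 := by
    have : vectorSpan ℝ F ≤ LinearMap.ker ((g - f : StrongDual ℝ E) : E →ₗ[ℝ] ℝ) := by
      refine Submodule.span_le.2 ?_
      rintro _ ⟨y, hy, z, hz, rfl⟩
      have h1 := hgf y hy
      have h2 := hgf z hz
      simp
      linarith
    exact this hvs
  have hgv' : 0 ≤ g v := nonneg_of_mem_tangentCone hxC hvT g fun y hy => by
    rw [map_sub, hgx]
    linarith [hg y hy]
  simp at hgv
  linarith

theorem isFace_of_isExposed {C F : Set E} (hC : Convex ℝ C) (hcl : IsClosed C)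
    (h : IsExposed ℝ C F) : IsFace C F :=
  ⟨h.isClosed hcl, h.convex hC, h.isExtreme⟩

theorem isExposed_of_support {C : Set E} (g : StrongDual ℝ E) (d : ℝ) (hg : ∀ y ∈ C, d ≤ g y) :
    IsExposed ℝ C {y ∈ C | g y = d} := by
  rintro ⟨x, hx, hxd⟩
  refine ⟨-g, Set.ext fun y => and_congr_right fun hy => ⟨fun h z hz => ?_, fun h => ?_⟩⟩
  · simpa [h] using hg z hz
  · exact le_antisymm (by simpa [hxd] using h x hx) (hg y hy)

/-- An exposed face `G` of minimal dimension among those containing `F` equals `F`: otherwise a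
functional supporting `G` along `F` extends to `C` and cuts out a smaller exposed face. -/
theorem FaceExtension.faciallyExposed [FiniteDimensional ℝ E] {C : Set E} (hC : Convex ℝ C)
    (hcl : IsClosed C) (h : FaceExtension C) : FaciallyExposed C := by
  rintro F ⟨hF, hF0, -⟩
  suffices key : ∀ (n : ℕ) (G : Set E), Module.finrank ℝ (vectorSpan ℝ G) = n → F ⊆ G →
      IsExposed ℝ C G → IsExposed ℝ C F from
    key _ C rfl hF.isExtreme.subset (IsExposed.refl C)
  intro n
  induction n using Nat.strong_induction_on with
  | _ n ih =>
    intro G hn hFG hG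
    by_cases hne : F = G
    · rwa [hne]
    have hGface := isFace_of_isExposed hC hcl hG
    obtain ⟨f, c, h1, h2, z, hz, hcz⟩ := exists_support hGface.convex hF.convex
      (hF.isExtreme.mono hG.subset hFG) hF0 hne
    obtain ⟨g, d, h3, h4⟩ := h G hGface f c h1
    refine ih _ ?_ (G ∩ {y ∈ C | g y = d}) rfl ?_ (hG.inter (isExposed_of_support g d h3))
    · -- the direction from a point of `F` to `z` is lost
      rw [← hn]
      apply Submodule.finrank_lt_finrank_of_lt
      refine lt_of_le_of_ne (vectorSpan_mono ℝ inter_subset_left) fun heq => ?_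
      obtain ⟨x, hx⟩ := hF0
      have hker : vectorSpan ℝ (G ∩ {y ∈ C | g y = d}) ≤ LinearMap.ker (g : E →ₗ[ℝ] ℝ) := by
        refine Submodule.span_le.2 ?_
        rintro _ ⟨y, ⟨-, -, hy⟩, w, ⟨-, -, hw⟩, rfl⟩
        simp [hy, hw]
      rw [heq] at hker
      have h5 : g (z - x) = 0 := hker (vsub_mem_vectorSpan ℝ hz (hFG hx))
      rw [map_sub] at h5
      have h6 := h4 z hz
      have h7 := h4 x (hFG hx)
      have h8 := h2 x hx
      linarith
    · intro x hx
      refine ⟨hFG hx, hF.isExtreme.subset hx, ?_⟩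
      have h7 := h4 x (hFG hx)
      have h8 := h2 x hx
      linarith

theorem IsFace.zero_mem {K : PointedCone ℝ E} {F : Set E} (hF : IsFace (K : Set E) F)
    (hne : F.Nonempty) : (0 : E) ∈ F := by
  obtain ⟨x, hx⟩ := hne
  have hxK : x ∈ K := hF.isExtreme.subset hx
  refine hF.isExtreme.left_mem_of_mem_openSegment K.zero_mem
    (K.smul_mem zero_le_two hxK : (2 : ℝ) • x ∈ K) hx ?_
  exact ⟨1 / 2, 1 / 2, by norm_num, by norm_num, by norm_num, by simp [smul_smul]⟩

theorem IsFace.smul_mem {K : PointedCone ℝ E} {F : Set E} (hF : IsFace (K : Set E) F) {x : E}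
    (hx : x ∈ F) {t : ℝ} (ht : 0 ≤ t) : t • x ∈ F := by
  have hxK : x ∈ K := hF.isExtreme.subset hx
  have h0 := hF.zero_mem ⟨x, hx⟩
  rcases le_or_gt t 1 with h1 | h1
  · have := hF.convex h0 hx (sub_nonneg.2 h1) ht (by ring)
    simpa using this
  · have ht0 : 0 < t := by linarith
    refine hF.isExtreme.right_mem_of_mem_openSegment K.zero_mem
      (K.smul_mem ht hxK : t • x ∈ K) hx
      ⟨1 - t⁻¹, t⁻¹, sub_pos.2 (inv_lt_one_of_one_lt₀ h1), by positivity, by ring, ?_⟩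
    rw [smul_zero, zero_add, inv_smul_smul₀ ht0.ne']

/-- The extension property says that `K* + F^⊥` is the whole dual cone of `F`. -/
theorem FaceExtension.faciallyDualComplete [CompleteSpace E] {K : PointedCone ℝ E}
    (h : FaceExtension (K : Set E)) : FaciallyDualComplete (K : Set E) := by
  rintro F ⟨hF, hF0, -⟩
  have h0 := hF.zero_mem hF0
  suffices heq : (ProperCone.innerDual (K : Set E) : Set E) + ((Submodule.span ℝ F)ᗮ : Set E)
      = (ProperCone.innerDual F : Set E) by
    rw [heq]
    exact (ProperCone.innerDual F).isClosed
  ext s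
  simp only [Set.mem_add, SetLike.mem_coe, ProperCone.mem_innerDual]
  constructor
  · rintro ⟨a, ha, b, hb, rfl⟩ x hx
    rw [inner_add_right, Submodule.inner_right_of_mem_orthogonal (Submodule.subset_span hx) hb,
      add_zero]
    exact ha (hF.isExtreme.subset hx)
  · intro hs
    obtain ⟨g, d, hg, hgf⟩ := h F hF (InnerProductSpace.toDual ℝ E s) 0 fun y hy => by
      rw [InnerProductSpace.toDual_apply_apply, real_inner_comm]
      exact hs hy
    obtain rfl : d = 0 := by simpa using hgf 0 h0
    obtain ⟨a, rfl⟩ := (InnerProductSpace.toDual ℝ E).surjective g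
    simp only [InnerProductSpace.toDual_apply_apply, sub_zero] at hg hgf
    refine ⟨a, fun x hx => by rw [real_inner_comm]; exact hg x hx, s - a, ?_, by simp⟩
    rw [Submodule.mem_orthogonal]
    intro u hu
    induction hu using Submodule.span_induction with
    | mem x hx => rw [inner_sub_right, real_inner_comm, real_inner_comm a, hgf x hx, sub_self]
    | zero => simp
    | add x y _ _ hx hy => rw [inner_add_left, hx, hy, add_zero]
    | smul t x _ hx => rw [real_inner_smul_left, hx, mul_zero]

end Convexity

/-! ### A criterion for tangent cones that are not exposed -/

section TangentConeCriterion

variable {E : Type*} [NormedAddCommGroup E] [InnerProductSpace ℝ E]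

/-- The initial velocity of a circular arc that starts at `z` and runs in `S` is tangent to `S`. -/
theorem mem_tangentCone_of_arc {S : Set E} {z p e : E}
    (h : ∀ u ∈ Icc (0 : ℝ) 1, z + (Real.sin u • p + (Real.cos u - 1) • e) ∈ S) :
    p ∈ tangentCone S z := by
  have hz : z ∈ S := by simpa using h 0 ⟨le_rfl, zero_le_one⟩
  rw [mem_tangentCone_iff hz]
  refine ⟨fun n => n + 1, fun n => z + (Real.sin (1 / ((n : ℝ) + 1)) • p +
    (Real.cos (1 / ((n : ℝ) + 1)) - 1) • e), tendsto_atTop_add_const_right _ _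
    tendsto_natCast_atTop_atTop, fun n => h _ ⟨by positivity, ?_⟩, ?_⟩
  · exact div_le_one_of_le₀ (by simp) (by positivity)
  · have hd : HasDerivAt (fun u : ℝ => Real.sin u • p + (Real.cos u - 1) • e) p 0 := by
      have h1 := ((Real.hasDerivAt_sin 0).smul_const p).add
        (((Real.hasDerivAt_cos 0).sub_const 1).smul_const e)
      exact h1.congr_deriv (by simp)
    rw [hasDerivAt_iff_tendsto_slope_zero] at hd
    have hu : Tendsto (fun n : ℕ => 1 / ((n : ℝ) + 1)) atTop (𝓝[≠] 0) :=
      tendsto_nhdsWithin_iff.2 ⟨tendsto_one_div_add_atTop_nhds_zero_nat,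
        Eventually.of_forall fun n => by simp; positivity⟩
    refine (hd.comp hu).congr fun n => ?_
    simp

/-- Suppose that `C` contains an arc issuing from `x` with velocity `p`, and that an arc issuing
from `x + q` with velocity `-p` also lies in `C`, both bending in the direction `-e`. If `C - x`
satisfies the inequalities `0 ≤ A + 2 r B + r ^ 2 D` for all `r ≥ 0`, then the face `A = 0` of the
tangent cone lies in the halfspace `0 ≤ B`. The tangent `-p` at its point `q` does not, so the
tangent cone is not tangentially exposed; and as a functional that supports the tangent cone and
vanishes at `q` also vanishes at `p`, the face `A = B = 0` is not exposed. -/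
theorem not_exposed_tangentCone_of_arcs {C : Set E} (hC : Convex ℝ C) {x p e q : E}
    (A B D : StrongDual ℝ E)
    (hABD : ∀ y ∈ C, ∀ r : ℝ, 0 ≤ r → 0 ≤ A (y - x) + 2 * r * B (y - x) + r ^ 2 * D (y - x))
    (harc₁ : ∀ u ∈ Icc (0 : ℝ) 1, x + (Real.sin u • p + (Real.cos u - 1) • e) ∈ C)
    (harc₂ : ∀ u ∈ Icc (0 : ℝ) 1, x + q + (Real.sin u • (-p) + (Real.cos u - 1) • e) ∈ C)
    (hAp : A p = 0) (hAq : A q = 0) (hBp : 0 < B p) (hBq : B q = 0)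
    (hA : ∃ y ∈ C, 0 < A (y - x)) :
    ¬ FaciallyExposed (tangentCone C x) ∧ ¬ TangentiallyExposed (tangentCone C x) := by
  have hx : x ∈ C := by simpa using harc₁ 0 ⟨le_rfl, zero_le_one⟩
  have hTconv : Convex ℝ (tangentCone C x) := convex_tangentCone hC hx
  have hTcl : IsClosed (tangentCone C x) := isClosed_tangentCone C x
  have hT0 : (0 : E) ∈ tangentCone C x := by simpa using sub_mem_tangentCone hC hx hx
  have hpT : p ∈ tangentCone C x := mem_tangentCone_of_arc harc₁
  have hqT : q ∈ tangentCone C x := by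
    simpa using sub_mem_tangentCone hC hx (harc₂ 0 ⟨le_rfl, zero_le_one⟩)
  have hpTq : -p ∈ tangentCone (tangentCone C x) q := by
    refine mem_tangentCone_of_arc (e := e) fun u hu => ?_
    have := sub_mem_tangentCone hC hx (harc₂ u hu)
    rwa [add_assoc x, add_sub_cancel_left] at this
  have hL : ∀ v ∈ tangentCone C x, ∀ r : ℝ, 0 ≤ r → 0 ≤ A v + 2 * r * B v + r ^ 2 * D v :=
    fun v hv r hr => nonneg_of_mem_tangentCone hx hv (A + (2 * r) • B + (r ^ 2) • D)
      fun y hy => hABD y hy r hr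
  have hAnn : ∀ v ∈ tangentCone C x, 0 ≤ A v := fun v hv => by simpa using hL v hv 0 le_rfl
  have hBnn : ∀ v ∈ tangentCone C x, A v = 0 → 0 ≤ B v := by
    intro v hv hAv
    have hlim : Tendsto (fun r : ℝ => 2 * B v + r * D v) (𝓝[>] 0) (𝓝 (2 * B v)) := by
      have : Continuous fun r : ℝ => 2 * B v + r * D v := by fun_prop
      simpa using (this.tendsto 0).mono_left nhdsWithin_le_nhds
    have : 0 ≤ 2 * B v := by
      refine ge_of_tendsto hlim ?_
      filter_upwards [self_mem_nhdsWithin] with r hr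
      have hr' : 0 < r := hr
      have h := hL v hv r hr'.le
      rw [hAv] at h
      refine nonneg_of_mul_nonneg_right ?_ hr'
      linarith
    linarith
  obtain ⟨y, hy, hAy⟩ := hA
  have hyT := sub_mem_tangentCone hC hx hy
  have hexpF : IsExposed ℝ (tangentCone C x) {v ∈ tangentCone C x | A v = 0} :=
    isExposed_of_support A 0 hAnn
  constructor
  · intro hfe
    have hR : IsExposed ℝ {v ∈ tangentCone C x | A v = 0}
        {v ∈ {v ∈ tangentCone C x | A v = 0} | B v = 0} :=
      isExposed_of_support B 0 fun v hv => hBnn v hv.1 hv.2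
    have hRface : IsFace {v ∈ tangentCone C x | A v = 0}
        {v ∈ {v ∈ tangentCone C x | A v = 0} | B v = 0} :=
      isFace_of_isExposed (hexpF.convex hTconv) (hexpF.isClosed hTcl) hR
    have h0R : (0 : E) ∈ {v ∈ {v ∈ tangentCone C x | A v = 0} | B v = 0} := by simp [hT0]
    have hqR : q ∈ {v ∈ {v ∈ tangentCone C x | A v = 0} | B v = 0} := ⟨⟨hqT, hAq⟩, hBq⟩
    obtain ⟨l, hl⟩ := hfe _ ⟨⟨hRface.isClosed, hRface.convex,
      hexpF.isExtreme.trans hRface.isExtreme⟩, ⟨0, h0R⟩, fun h => by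
        rw [← h] at hyT
        exact hAy.ne' hyT.1.2⟩ ⟨0, h0R⟩
    have hq := hl ▸ hqR
    have h0 := hl ▸ h0R
    have hlnp : ∀ v ∈ tangentCone C x, l v ≤ 0 := fun v hv => by simpa using h0.2 v hv
    have hlq : l q = 0 := le_antisymm (hlnp q hqT) (by simpa using hq.2 0 hT0)
    have hlp : 0 ≤ l p := by
      have := nonneg_of_mem_tangentCone hqT hpTq (-l) fun v hv => by
        simpa [hlq] using hlnp v hv
      simpa using this
    have hpR : p ∈ {v ∈ {v ∈ tangentCone C x | A v = 0} | B v = 0} := by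
      rw [hl]
      exact ⟨hpT, fun v hv => (hlnp v hv).trans hlp⟩
    exact hBp.ne' hpR.2
  · intro hte
    have h0F : (0 : E) ∈ {v ∈ tangentCone C x | A v = 0} := by simp [hT0]
    have hpF : p ∈ {v ∈ tangentCone C x | A v = 0} := ⟨hpT, hAp⟩
    have hqF : q ∈ {v ∈ tangentCone C x | A v = 0} := ⟨hqT, hAq⟩
    have heq := hte _ (isFace_of_isExposed hTconv hTcl hexpF) (fun h => by
      rw [← h] at hyT
      exact hAy.ne' hyT.2) q hqF
    have hmem : -p ∈ tangentCone {v ∈ tangentCone C x | A v = 0} q := by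
      rw [← heq]
      exact ⟨hpTq, by simpa using vsub_mem_vectorSpan ℝ h0F hpF⟩
    have := nonneg_of_mem_tangentCone hqF hmem B fun v hv => by
      simpa [hBq] using hBnn v hv.1 hv.2
    simp only [map_neg] at this
    linarith

theorem not_stronglyTangentiallyExposed {C : Set E} {x : E} (hx : x ∈ C)
    (h : ¬ TangentiallyExposed (tangentCone C x)) : ¬ StronglyTangentiallyExposed C :=
  fun hs => h (hs 1 _ ⟨C, rfl, x, hx, rfl⟩)

end TangentConeCriterion

/-! ### Nonnegative trigonometric polynomials on the two arcs -/

section TrigPolynomials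

/-- A trigonometric polynomial of degree one that is nonnegative on `[0, L]` and has both an
interior zero `s` and another zero `t` in `[0, L]` vanishes identically: it has a double zero
at `s`, so that it equals `c * (1 - cos (u - s))`. -/
theorem eq_zero_of_nonneg_of_two_zeros {L : ℝ} (hL : L ≤ Real.pi) {a b c s t : ℝ}
    (h : ∀ u ∈ Icc 0 L, 0 ≤ a * Real.cos u + b * Real.sin u + c) (hs : s ∈ Ioo 0 L)
    (ht : t ∈ Icc 0 L) (hst : s ≠ t) (hs0 : a * Real.cos s + b * Real.sin s + c = 0)
    (ht0 : a * Real.cos t + b * Real.sin t + c = 0) : a = 0 ∧ b = 0 ∧ c = 0 := by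
  have hd : HasDerivAt (fun u => a * Real.cos u + b * Real.sin u + c)
      (a * (-Real.sin s) + b * Real.cos s) s :=
    (((Real.hasDerivAt_cos s).const_mul a).add ((Real.hasDerivAt_sin s).const_mul b)).add_const c
  have hmin : IsLocalMin (fun u => a * Real.cos u + b * Real.sin u + c) s := by
    filter_upwards [Icc_mem_nhds hs.1 hs.2] with u hu
    rw [hs0]
    exact h u hu
  have hd0 := hmin.hasDerivAt_eq_zero hd
  have hsq := Real.sin_sq_add_cos_sq s
  have ha : a = -c * Real.cos s := by
    linear_combination (-a) * hsq - Real.sin s * hd0 + Real.cos s * hs0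
  have hb : b = -c * Real.sin s := by
    linear_combination (-b) * hsq + Real.cos s * hd0 + Real.sin s * hs0
  have hc : c = 0 := by
    have h1 : c * (1 - Real.cos (t - s)) = 0 := by
      rw [Real.cos_sub]
      rw [ha, hb] at ht0
      linear_combination ht0
    rcases mul_eq_zero.1 h1 with h2 | h2
    · exact h2
    · have h3 : t - s = 0 := (Real.cos_eq_one_iff_of_lt_of_lt
        (by linarith [hs.2, ht.1, Real.pi_pos]) (by linarith [hs.1, ht.2, Real.pi_pos])).1
        (by linarith)
      exact absurd (by linarith) hst
  simp [ha, hb, hc]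

theorem trigPolynomial_add_abs_nonneg (a b u : ℝ) :
    0 ≤ a * Real.cos u + b * Real.sin u + (|a| + |b|) := by
  have h1 : |a * Real.cos u| ≤ |a| := by
    rw [abs_mul]
    exact mul_le_of_le_one_right (abs_nonneg a) (Real.abs_cos_le_one u)
  have h2 : |b * Real.sin u| ≤ |b| := by
    rw [abs_mul]
    exact mul_le_of_le_one_right (abs_nonneg b) (Real.abs_sin_le_one u)
  linarith [neg_abs_le (a * Real.cos u), neg_abs_le (b * Real.sin u)]

theorem subsingleton_or_endpoints_or_eq {L : ℝ} {P : Set ℝ} (hP : P ⊆ Icc 0 L)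
    (h : ∀ s ∈ P, ∀ t ∈ P, s ≠ t → s ∈ Ioo 0 L → P = Icc 0 L) :
    P.Subsingleton ∨ P = {0, L} ∨ P = Icc 0 L := by
  by_cases hall : P = Icc 0 L
  · exact Or.inr (Or.inr hall)
  by_cases hsub : P.Subsingleton
  · exact Or.inl hsub
  refine Or.inr (Or.inl ?_)
  obtain ⟨s, hs, t, ht, hst⟩ := Set.not_subsingleton_iff.1 hsub
  have hend : ∀ u ∈ P, u = 0 ∨ u = L := by
    intro u hu
    by_contra! hcon
    have hu' : u ∈ Ioo 0 L :=
      ⟨lt_of_le_of_ne (hP hu).1 hcon.1.symm, lt_of_le_of_ne (hP hu).2 hcon.2⟩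
    rcases eq_or_ne u s with rfl | hus
    · exact hall (h u hs t ht hst hu')
    · exact hall (h u hu s hs hus hu')
  apply Subset.antisymm
  · exact fun u hu => hend u hu
  · rintro u (rfl | rfl) <;> rcases hend s hs with h1 | h1 <;> rcases hend t ht with h2 | h2 <;>
      grind

/-- The affine functions on `ℝ³` restrict to the two arcs as pairs of trigonometric polynomials
`a cos + b sin + c₁` and `a cos + b sin + c₂`. This structure says that such a pair is nonnegative
on both arcs. -/
structure ArcNonneg (a b c₁ c₂ : ℝ) : Prop where
  top : ∀ u ∈ Icc 0 (Real.pi / 2), 0 ≤ a * Real.cos u + b * Real.sin u + c₁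
  bottom : ∀ u ∈ Icc 0 Real.pi, 0 ≤ a * Real.cos u + b * Real.sin u + c₂

/-- If the chord of the top arc is joined to a point `t` of the bottom arc in a proper face, then
that face is the triangle with vertices `(1, 0, 1)`, `(0, 1, 1)` and `(-1, 0, -1)`. -/
theorem ArcNonneg.eq_pi {a b c₁ c₂ t : ℝ} (h : ArcNonneg a b c₁ c₂)
    (hne : ¬ (a = 0 ∧ b = 0 ∧ c₁ = 0 ∧ c₂ = 0))
    (h0 : a + c₁ = 0) (h1 : b + c₁ = 0) (ht : t ∈ Icc 0 Real.pi)
    (ht0 : a * Real.cos t + b * Real.sin t + c₂ = 0) : t = Real.pi := by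
  obtain rfl : b = a := by linarith
  obtain rfl : c₁ = -b := by linarith
  have hb : 0 ≤ b := by
    have h2 := h.top (Real.pi / 4) ⟨by positivity, by linarith [Real.pi_pos]⟩
    rw [Real.cos_pi_div_four, Real.sin_pi_div_four] at h2
    have h3 : (1 : ℝ) < √2 := Real.lt_sqrt_of_sq_lt (by norm_num)
    by_contra! hb
    nlinarith
  have hpi := h.bottom Real.pi ⟨Real.pi_pos.le, le_rfl⟩
  rw [Real.cos_pi, Real.sin_pi] at hpi
  by_contra hcon
  have hlt : t < Real.pi := lt_of_le_of_ne ht.2 hcon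
  have hcos : -1 < Real.cos t := by
    rw [← Real.cos_pi]
    exact Real.cos_lt_cos_of_nonneg_of_le_pi ht.1 le_rfl hlt
  have hsin : 0 ≤ Real.sin t := Real.sin_nonneg_of_nonneg_of_le_pi ht.1 ht.2
  have hb0 : b = 0 := by
    by_contra hb0
    have hbpos : 0 < b := lt_of_le_of_ne hb (Ne.symm hb0)
    have : 0 < b * (1 + Real.cos t + Real.sin t) := mul_pos hbpos (by linarith)
    linarith
  subst hb0
  exact hne ⟨rfl, rfl, by ring, by linarith⟩

/-- If the chord of the bottom arc is joined to a point `s` of the top arc in a proper face, then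
that face is the triangle with vertices `(1, 0, -1)`, `(-1, 0, -1)` and `(1, 0, 1)`. -/
theorem ArcNonneg.eq_zero {a b c₁ c₂ s : ℝ} (h : ArcNonneg a b c₁ c₂)
    (hne : ¬ (a = 0 ∧ b = 0 ∧ c₁ = 0 ∧ c₂ = 0))
    (h0 : a + c₂ = 0) (h1 : -a + c₂ = 0) (hs : s ∈ Icc 0 (Real.pi / 2))
    (hs0 : a * Real.cos s + b * Real.sin s + c₁ = 0) : s = 0 := by
  obtain rfl : a = 0 := by linarith
  obtain rfl : c₂ = 0 := by linarith
  have hb := h.bottom (Real.pi / 2) ⟨by positivity, by linarith [Real.pi_pos]⟩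
  have hc := h.top 0 ⟨le_rfl, by positivity⟩
  simp only [Real.sin_pi_div_two, Real.cos_pi_div_two, Real.sin_zero, Real.cos_zero] at hb hc
  by_contra hcon
  have hsin : 0 < Real.sin s := Real.sin_pos_of_pos_of_lt_pi
    (lt_of_le_of_ne hs.1 (Ne.symm hcon)) (by linarith [hs.2, Real.pi_pos])
  have hb0 : b = 0 := by
    by_contra hb0
    have := mul_pos (lt_of_le_of_ne (by linarith) (Ne.symm hb0)) hsin
    linarith
  subst hb0
  exact hne ⟨rfl, rfl, by linarith, rfl⟩

theorem exists_const_of_subsingleton {P : Set ℝ} (hP : P.Subsingleton) (f : ℝ → ℝ)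
    (hf : ∀ u ∈ P, 0 ≤ f u) : ∃ v, 0 ≤ v ∧ ∀ u ∈ P, f u = v := by
  rcases hP.eq_empty_or_singleton with rfl | ⟨s, rfl⟩
  · exact ⟨0, le_rfl, by simp⟩
  · exact ⟨f s, hf s rfl, by simp⟩

/-- The extension property in terms of the parameters `P` and `Q` of the points of a proper face
on the top and on the bottom arc. -/
theorem exists_arcNonneg_extension {P Q : Set ℝ}
    (hP : P ⊆ Icc 0 (Real.pi / 2)) (hQ : Q ⊆ Icc 0 Real.pi)
    (hP' : ∀ s ∈ P, ∀ t ∈ P, s ≠ t → s ∈ Ioo 0 (Real.pi / 2) → P = Icc 0 (Real.pi / 2))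
    (hQ' : ∀ s ∈ Q, ∀ t ∈ Q, s ≠ t → s ∈ Ioo 0 Real.pi → Q = Icc 0 Real.pi)
    {a' b' c₁' c₂' : ℝ} (hsupp : ArcNonneg a' b' c₁' c₂')
    (hne : ¬ (a' = 0 ∧ b' = 0 ∧ c₁' = 0 ∧ c₂' = 0))
    (hPs : ∀ u ∈ P, a' * Real.cos u + b' * Real.sin u + c₁' = 0)
    (hQs : ∀ u ∈ Q, a' * Real.cos u + b' * Real.sin u + c₂' = 0)
    {a b c₁ c₂ : ℝ} (hPn : ∀ u ∈ P, 0 ≤ a * Real.cos u + b * Real.sin u + c₁)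
    (hQn : ∀ u ∈ Q, 0 ≤ a * Real.cos u + b * Real.sin u + c₂) :
    ∃ α β γ₁ γ₂ : ℝ, ArcNonneg α β γ₁ γ₂ ∧
      (∀ u ∈ P, α * Real.cos u + β * Real.sin u + γ₁ = a * Real.cos u + b * Real.sin u + c₁) ∧
      (∀ u ∈ Q, α * Real.cos u + β * Real.sin u + γ₂ = a * Real.cos u + b * Real.sin u + c₂) := by
  have hpi := Real.pi_pos
  have hsin : ∀ u ∈ Icc 0 Real.pi, 0 ≤ Real.sin u := fun u hu =>
    Real.sin_nonneg_of_nonneg_of_le_pi hu.1 hu.2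
  have hcos : ∀ u ∈ Icc 0 (Real.pi / 2), 0 ≤ Real.cos u := fun u hu =>
    Real.cos_nonneg_of_neg_pi_div_two_le_of_le (by linarith [hu.1]) hu.2
  have hsin' : ∀ u ∈ Icc 0 (Real.pi / 2), 0 ≤ Real.sin u := fun u hu =>
    hsin u ⟨hu.1, by linarith [hu.2]⟩
  have hchordP : 0 ∈ P → Real.pi / 2 ∈ P → ∀ t ∈ Q, t = Real.pi := fun h0 h1 t ht =>
    hsupp.eq_pi hne (by simpa using hPs 0 h0) (by simpa using hPs _ h1) (hQ ht) (hQs t ht)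
  have hchordQ : 0 ∈ Q → Real.pi ∈ Q → ∀ s ∈ P, s = 0 := fun h0 h1 s hs =>
    hsupp.eq_zero hne (by simpa using hQs 0 h0) (by simpa using hQs _ h1) (hP hs) (hPs s hs)
  rcases subsingleton_or_endpoints_or_eq hP hP' with hP1 | hP1 | hP1
  · rcases subsingleton_or_endpoints_or_eq hQ hQ' with hQ1 | hQ1 | hQ1
    · -- at most one point on each arc: a function of the height alone
      obtain ⟨v, hv, hPv⟩ := exists_const_of_subsingleton hP1 _ hPn
      obtain ⟨w, hw, hQw⟩ := exists_const_of_subsingleton hQ1 _ hQn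
      refine ⟨0, 0, v, w, ⟨fun u _ => by simpa using hv, fun u _ => by simpa using hw⟩,
        fun u hu => ?_, fun u hu => ?_⟩
      · rw [hPv u hu]; ring
      · rw [hQw u hu]; ring
    · -- the chord of the bottom arc, possibly with the point `(1, 0, 1)`
      have h0 : (0 : ℝ) ∈ Q := by simp [hQ1]
      have h1 : Real.pi ∈ Q := by simp [hQ1]
      have hP0 := hchordQ h0 h1
      obtain ⟨v, hv, hPv⟩ := exists_const_of_subsingleton hP1 _ hPn
      have hw0 : 0 ≤ a + c₂ := by simpa using hQn 0 h0
      have hw1 : 0 ≤ -a + c₂ := by simpa using hQn _ h1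
      refine ⟨a, |a|, v - a, c₂, ⟨fun u hu => ?_, fun u hu => ?_⟩, fun u hu => ?_, ?_⟩
      · have h2 : 1 - Real.cos u ≤ Real.sin u := by
          nlinarith [Real.sin_sq_add_cos_sq u, hsin' u hu, hcos u hu]
        have h3 : a * (1 - Real.cos u) ≤ |a| * Real.sin u :=
          mul_le_mul (le_abs_self a) h2 (by linarith [Real.cos_le_one u]) (abs_nonneg a)
        linarith
      · have h2 : |a * Real.cos u| ≤ |a| := by
          rw [abs_mul]
          exact mul_le_of_le_one_right (abs_nonneg a) (Real.abs_cos_le_one u)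
        have h3 : |a| ≤ c₂ := abs_le.2 ⟨by linarith, by linarith⟩
        linarith [neg_abs_le (a * Real.cos u), mul_nonneg (abs_nonneg a) (hsin u hu)]
      · have h2 := hPv u hu
        obtain rfl := hP0 u hu
        simp only [Real.cos_zero, Real.sin_zero] at h2 ⊢
        linarith
      · rw [hQ1]
        rintro u (rfl | rfl) <;> simp
    · -- the bottom half-disk
      have h0 : (0 : ℝ) ∈ Q := by simp [hQ1, hpi.le]
      have h1 : Real.pi ∈ Q := by simp [hQ1, hpi.le]
      have h2 : Real.pi / 2 ∈ Q := by rw [hQ1]; exact ⟨by positivity, by linarith⟩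
      refine ⟨a, b, |a| + |b|, c₂, ⟨fun u _ => trigPolynomial_add_abs_nonneg a b u, ?_⟩, fun u hu => ?_,
        fun _ _ => rfl⟩
      · rwa [hQ1] at hQn
      · exfalso
        obtain ⟨ha, hb, hc⟩ := eq_zero_of_nonneg_of_two_zeros le_rfl hsupp.bottom
          ⟨by positivity, by linarith⟩ (hQ h0) (by positivity : Real.pi / 2 ≠ 0) (hQs _ h2)
          (hQs _ h0)
        exact hne ⟨ha, hb, by simpa [ha, hb] using hPs u hu, hc⟩
  · -- the chord of the top arc, possibly with the point `(-1, 0, -1)`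
    have h0 : (0 : ℝ) ∈ P := by simp [hP1]
    have h1 : Real.pi / 2 ∈ P := by simp [hP1]
    have hQpi := hchordP h0 h1
    have hv0 : 0 ≤ a + c₁ := by simpa using hPn 0 h0
    have hv1 : 0 ≤ b + c₁ := by simpa using hPn _ h1
    obtain ⟨w, hw, hQw⟩ := exists_const_of_subsingleton
      (fun s hs t ht => (hQpi s hs).trans (hQpi t ht).symm) _ hQn
    refine ⟨a + c₁, b + c₁, 0, w + (a + c₁), ⟨fun u hu => ?_, fun u hu => ?_⟩, ?_, fun u hu => ?_⟩
    · linarith [mul_nonneg hv0 (hcos u hu), mul_nonneg hv1 (hsin' u hu)]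
    · have h2 : 0 ≤ (a + c₁) * (Real.cos u + 1) :=
        mul_nonneg hv0 (by linarith [Real.neg_one_le_cos u])
      linarith [mul_nonneg hv1 (hsin u hu)]
    · rw [hP1]
      rintro u (rfl | rfl) <;> simp
    · have h2 := hQw u hu
      obtain rfl := hQpi u hu
      simp only [Real.cos_pi, Real.sin_pi] at h2 ⊢
      linarith
  · -- the top circular segment
    have h0 : (0 : ℝ) ∈ P := by rw [hP1]; exact ⟨le_rfl, by positivity⟩
    have h1 : Real.pi / 4 ∈ P := by rw [hP1]; exact ⟨by positivity, by linarith⟩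
    refine ⟨a, b, c₁, |a| + |b|, ⟨?_, fun u _ => trigPolynomial_add_abs_nonneg a b u⟩, fun _ _ => rfl,
      fun u hu => ?_⟩
    · rwa [hP1] at hPn
    · exfalso
      obtain ⟨ha, hb, hc⟩ := eq_zero_of_nonneg_of_two_zeros (by linarith) hsupp.top
        ⟨by positivity, by linarith⟩ (hP h0) (by positivity : Real.pi / 4 ≠ 0) (hPs _ h1)
        (hPs _ h0)
      exact hne ⟨ha, hb, hc, by simpa [ha, hb] using hQs u hu⟩

end TrigPolynomials

/-! ### Faces of the body -/

/-- In finite dimension the convex hull of a compact set is compact: by Carathéodory's theorem it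
is the image of a compact set of weights and points. -/
theorem isCompact_convexHull {E : Type*} [NormedAddCommGroup E] [NormedSpace ℝ E]
    [FiniteDimensional ℝ E] {s : Set E} (hs : IsCompact s) : IsCompact (convexHull ℝ s) := by
  rcases s.eq_empty_or_nonempty with rfl | ⟨x₀, hx₀⟩
  · simp
  let ι := Fin (Module.finrank ℝ E + 1)
  have hK : IsCompact (stdSimplex ℝ ι ×ˢ Set.univ.pi fun _ : ι => s) :=
    (isCompact_stdSimplex ℝ ι).prod (isCompact_univ_pi fun _ => hs)
  have hΦ : Continuous fun p : (ι → ℝ) × (ι → E) => ∑ i, p.1 i • p.2 i := by fun_prop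
  convert hK.image hΦ
  apply Subset.antisymm
  · intro x hx
    obtain ⟨κ, _, z, w, hz, hind, hw, hw1, rfl⟩ := eq_pos_convex_span_of_mem_convexHull hx
    have hcard : Fintype.card κ ≤ Fintype.card ι := by
      rw [Fintype.card_fin]
      exact hind.card_le_finrank_succ.trans (Nat.succ_le_succ (Submodule.finrank_le _))
    obtain ⟨e⟩ := Function.Embedding.nonempty_of_card_le hcard
    refine ⟨(Function.extend e w 0, Function.extend e z fun _ => x₀), ⟨⟨fun i => ?_, ?_⟩, ?_⟩, ?_⟩
    · by_cases hi : ∃ k, e k = i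
      · obtain ⟨k, rfl⟩ := hi
        simpa [e.injective.extend_apply] using (hw k).le
      · simp [Function.extend_apply' _ _ _ hi]
    · rw [← hw1]
      refine (Fintype.sum_of_injective e e.injective _ _ (fun i hi => ?_) fun k => ?_).symm
      · exact Function.extend_apply' _ _ _ hi
      · simp [e.injective.extend_apply]
    · intro i _
      by_cases hi : ∃ k, e k = i
      · obtain ⟨k, rfl⟩ := hi
        simpa [e.injective.extend_apply] using hz (mem_range_self k)
      · simpa [Function.extend_apply' _ _ _ hi] using hx₀
    · refine (Fintype.sum_of_injective e e.injective _ _ (fun i hi => ?_) fun k => ?_).symm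
      · have hi' : ¬ ∃ k, e k = i := hi
        simp [Function.extend_apply' _ _ _ hi']
      · simp [e.injective.extend_apply]
  · rintro _ ⟨⟨w, z⟩, ⟨⟨hw, hw1⟩, hz⟩, rfl⟩
    exact (convex_convexHull ℝ s).sum_mem (fun i _ => hw i) hw1
      fun i _ => subset_convexHull ℝ s (hz i trivial)

section Body

/-- The point `(cos t, sin t, z)` of the unit circle at height `z`. -/
def arcPoint (z t : ℝ) : EuclideanSpace ℝ (Fin 3) :=
  !₂[Real.cos t, Real.sin t, z]

theorem arcPoint_top_mem {t : ℝ} (ht : t ∈ Icc 0 (Real.pi / 2)) : arcPoint 1 t ∈ bodyC :=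
  subset_convexHull ℝ _ (Or.inl ⟨t, ht, rfl⟩)

theorem arcPoint_bottom_mem {t : ℝ} (ht : t ∈ Icc 0 Real.pi) : arcPoint (-1) t ∈ bodyC :=
  subset_convexHull ℝ _ (Or.inr ⟨t, ht, rfl⟩)

theorem isCompact_arcs : IsCompact (arcTop ∪ arcBottom) := by
  refine (isCompact_Icc.image ?_).union (isCompact_Icc.image ?_)
  all_goals
    refine (PiLp.continuous_toLp 2 _).comp (continuous_pi fun i => ?_)
    fin_cases i <;> simp <;> fun_prop

theorem isCompact_bodyC : IsCompact bodyC :=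
  isCompact_convexHull isCompact_arcs

theorem convex_bodyC : Convex ℝ bodyC :=
  convex_convexHull ℝ _

theorem strongDual_apply (f : StrongDual ℝ (EuclideanSpace ℝ (Fin 3)))
    (x : EuclideanSpace ℝ (Fin 3)) : f x = f (EuclideanSpace.single 0 1) * x 0 +
      f (EuclideanSpace.single 1 1) * x 1 + f (EuclideanSpace.single 2 1) * x 2 := by
  have hx : x = x 0 • EuclideanSpace.single 0 1 + x 1 • EuclideanSpace.single 1 1 +
      x 2 • EuclideanSpace.single 2 1 := by
    ext i
    fin_cases i <;> simp
  conv_lhs => rw [hx]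
  simp only [map_add, map_smul, smul_eq_mul]
  ring

theorem strongDual_arcPoint (f : StrongDual ℝ (EuclideanSpace ℝ (Fin 3))) (z t : ℝ) :
    f (arcPoint z t) = f (EuclideanSpace.single 0 1) * Real.cos t +
      f (EuclideanSpace.single 1 1) * Real.sin t + f (EuclideanSpace.single 2 1) * z := by
  rw [strongDual_apply]
  simp [arcPoint]

theorem le_on_bodyC {f : StrongDual ℝ (EuclideanSpace ℝ (Fin 3))} {c : ℝ}
    (h₁ : ∀ t ∈ Icc 0 (Real.pi / 2), c ≤ f (arcPoint 1 t))
    (h₂ : ∀ t ∈ Icc 0 Real.pi, c ≤ f (arcPoint (-1) t)) : ∀ y ∈ bodyC, c ≤ f y := by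
  refine convexHull_min (t := {y | c ≤ f y}) ?_ (convex_halfSpace_ge f.isLinear c)
  rintro _ (⟨t, ht, rfl⟩ | ⟨t, ht, rfl⟩)
  · exact h₁ t ht
  · exact h₂ t ht

/-- A face of `bodyC` is the closed convex hull of its points on the two arcs. -/
theorem IsFace.subset_closure_convexHull_arcs {F : Set (EuclideanSpace ℝ (Fin 3))}
    (hF : IsFace bodyC F) : F ⊆ closure (convexHull ℝ (F ∩ (arcTop ∪ arcBottom))) := by
  have hFc : IsCompact F := isCompact_bodyC.of_isClosed_subset hF.isClosed hF.isExtreme.subset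
  conv_lhs => rw [← closure_convexHull_extremePoints hFc hF.convex]
  exact closure_mono (convexHull_mono (subset_inter extremePoints_subset
    (hF.isExtreme.extremePoints_subset_extremePoints.trans extremePoints_convexHull_subset)))

theorem IsFace.eqOn_of_eqOn_arcs {F : Set (EuclideanSpace ℝ (Fin 3))} (hF : IsFace bodyC F)
    {f : StrongDual ℝ (EuclideanSpace ℝ (Fin 3))} {c : ℝ}
    (h : ∀ y ∈ F ∩ (arcTop ∪ arcBottom), f y = c) : ∀ y ∈ F, f y = c := by
  intro y hy
  have h1 : convexHull ℝ (F ∩ (arcTop ∪ arcBottom)) ⊆ {y | f y = c} :=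
    convexHull_min h (convex_hyperplane f.isLinear c)
  exact closure_minimal h1 (isClosed_eq f.continuous continuous_const)
    (hF.subset_closure_convexHull_arcs hy)

/-- A face that contains two points of an arc, one of them not an endpoint, contains the arc. -/
theorem IsFace.arc_subset {F : Set (EuclideanSpace ℝ (Fin 3))} (hF : IsFace bodyC F) {z L : ℝ}
    (hL : L ≤ Real.pi) (harc : ∀ u ∈ Icc 0 L, arcPoint z u ∈ bodyC) {s t : ℝ}
    (hs : s ∈ Ioo 0 L) (ht : t ∈ Icc 0 L) (hst : s ≠ t) (hsF : arcPoint z s ∈ F)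
    (htF : arcPoint z t ∈ F) : ∀ u ∈ Icc 0 L, arcPoint z u ∈ F := by
  set D := convexHull ℝ (arcPoint z '' Icc 0 L) with hD
  have hDC : D ⊆ bodyC := convexHull_min (by rintro _ ⟨u, hu, rfl⟩; exact harc u hu) convex_bodyC
  have hmem : ∀ u ∈ Icc 0 L, arcPoint z u ∈ D := fun u hu =>
    subset_convexHull ℝ _ (mem_image_of_mem _ hu)
  have hex : IsExtreme ℝ D (F ∩ D) := by
    refine ⟨inter_subset_right, fun x hx y hy w hw hwxy => ⟨?_, hx⟩⟩
    exact hF.isExtreme.left_mem_of_mem_openSegment (hDC hx) (hDC hy) hw.1 hwxy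
  have hsIcc : s ∈ Icc 0 L := Ioo_subset_Icc_self hs
  by_contra! hcon
  obtain ⟨w, hw, hwF⟩ := hcon
  obtain ⟨f, c, h1, h2, y, hy, hcy⟩ := exists_support (convex_convexHull ℝ _)
    (hF.convex.inter (convex_convexHull ℝ _)) hex ⟨_, hsF, hmem s hsIcc⟩ fun h => by
      have := hmem w hw
      rw [hD, ← h] at this
      exact hwF this.1
  obtain ⟨ha, hb, hc⟩ := eq_zero_of_nonneg_of_two_zeros hL
    (a := f (EuclideanSpace.single 0 1)) (b := f (EuclideanSpace.single 1 1))
    (c := f (EuclideanSpace.single 2 1) * z - c)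
    (fun u hu => by linarith [h1 _ (hmem u hu), strongDual_arcPoint f z u]) hs ht hst
    (by linarith [h2 _ ⟨hsF, hmem s hsIcc⟩, strongDual_arcPoint f z s])
    (by linarith [h2 _ ⟨htF, hmem t ht⟩, strongDual_arcPoint f z t])
  have hconst : D ⊆ {y | f y = c} := by
    refine convexHull_min ?_ (convex_hyperplane f.isLinear c)
    rintro _ ⟨u, -, rfl⟩
    have := strongDual_arcPoint f z u
    rw [ha, hb] at this
    simp only [mem_ofPred_eq]
    linarith
  exact hcy.ne' (hconst hy)

theorem faceExtension_bodyC : FaceExtension bodyC := by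
  intro F hF f c hf
  rcases F.eq_empty_or_nonempty with rfl | hF0
  · exact ⟨0, 0, by simp, by simp⟩
  by_cases hne : F = bodyC
  · subst hne
    exact ⟨f, c, hf, fun _ _ => rfl⟩
  obtain ⟨g, d, hg, hgF, y, hy, hdy⟩ := exists_support convex_bodyC hF.convex hF.isExtreme hF0 hne
  obtain ⟨α, β, γ₁, γ₂, hn, hPe, hQe⟩ := exists_arcNonneg_extension
    (P := {t ∈ Icc 0 (Real.pi / 2) | arcPoint 1 t ∈ F})
    (Q := {t ∈ Icc 0 Real.pi | arcPoint (-1) t ∈ F})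
    (a' := g (EuclideanSpace.single 0 1)) (b' := g (EuclideanSpace.single 1 1))
    (c₁' := g (EuclideanSpace.single 2 1) * 1 - d) (c₂' := g (EuclideanSpace.single 2 1) * (-1) - d)
    (a := f (EuclideanSpace.single 0 1)) (b := f (EuclideanSpace.single 1 1))
    (c₁ := f (EuclideanSpace.single 2 1) * 1 - c) (c₂ := f (EuclideanSpace.single 2 1) * (-1) - c)
    (fun t ht => ht.1) (fun t ht => ht.1)
    (fun s hs t ht hst hsI => Subset.antisymm (fun t ht => ht.1) fun u hu =>
      ⟨hu, hF.arc_subset (by linarith [Real.pi_pos]) (fun _ => arcPoint_top_mem) hsI ht.1 hst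
        hs.2 ht.2 u hu⟩)
    (fun s hs t ht hst hsI => Subset.antisymm (fun t ht => ht.1) fun u hu =>
      ⟨hu, hF.arc_subset le_rfl (fun _ => arcPoint_bottom_mem) hsI ht.1 hst hs.2 ht.2 u hu⟩)
    ⟨fun u hu => by linarith [hg _ (arcPoint_top_mem hu), strongDual_arcPoint g 1 u],
      fun u hu => by linarith [hg _ (arcPoint_bottom_mem hu), strongDual_arcPoint g (-1) u]⟩
    (by
      rintro ⟨h0, h1, h2, h3⟩
      have h4 : g (EuclideanSpace.single 2 1) = 0 := by linarith
      have := strongDual_apply g y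
      rw [h0, h1, h4] at this
      linarith)
    (fun u hu => by linarith [hgF _ hu.2, strongDual_arcPoint g 1 u])
    (fun u hu => by linarith [hgF _ hu.2, strongDual_arcPoint g (-1) u])
    (fun u hu => by linarith [hf _ hu.2, strongDual_arcPoint f 1 u])
    (fun u hu => by linarith [hf _ hu.2, strongDual_arcPoint f (-1) u])
  let k : StrongDual ℝ (EuclideanSpace ℝ (Fin 3)) := α • EuclideanSpace.proj 0 +
    β • EuclideanSpace.proj 1 + ((γ₁ - γ₂) / 2) • EuclideanSpace.proj 2
  have hk : ∀ z t, k (arcPoint z t) = α * Real.cos t + β * Real.sin t + (γ₁ - γ₂) / 2 * z := by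
    intro z t
    simp [k, arcPoint]
  refine ⟨k, -(γ₁ + γ₂) / 2, le_on_bodyC (fun t ht => ?_) fun t ht => ?_, fun y hy => ?_⟩
  · linarith [hk 1 t, hn.top t ht]
  · linarith [hk (-1) t, hn.bottom t ht]
  · have key := hF.eqOn_of_eqOn_arcs (f := k - f) (c := -(γ₁ + γ₂) / 2 - c) (by
      rintro _ ⟨hy, ⟨t, ht, rfl⟩ | ⟨t, ht, rfl⟩⟩
      · change k (arcPoint 1 t) - f (arcPoint 1 t) = _
        linarith [hk 1 t, hPe t ⟨ht, hy⟩, strongDual_arcPoint f 1 t]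
      · change k (arcPoint (-1) t) - f (arcPoint (-1) t) = _
        linarith [hk (-1) t, hQe t ⟨ht, hy⟩, strongDual_arcPoint f (-1) t]) y hy
    change k y - f y = _ at key
    linarith

end Body

/-! ### The homogenization -/

section Homogenization

/-- The embedding `x ↦ (x, 0)` of `ℝ³` into `ℝ⁴`, the linear part of `homLift`. -/
def inclL : EuclideanSpace ℝ (Fin 3) →L[ℝ] EuclideanSpace ℝ (Fin 4) :=
  LinearMap.toContinuousLinearMap
    { toFun := fun x => !₂[x 0, x 1, x 2, 0]
      map_add' := fun x y => by ext i; fin_cases i <;> simp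
      map_smul' := fun t x => by ext i; fin_cases i <;> simp }

/-- The projection of `ℝ⁴` onto the first three coordinates. -/
def projL : EuclideanSpace ℝ (Fin 4) →L[ℝ] EuclideanSpace ℝ (Fin 3) :=
  LinearMap.toContinuousLinearMap
    { toFun := fun x => !₂[x 0, x 1, x 2]
      map_add' := fun x y => by ext i; fin_cases i <;> simp
      map_smul' := fun t x => by ext i; fin_cases i <;> simp }

theorem inclL_apply (x : EuclideanSpace ℝ (Fin 3)) : inclL x = !₂[x 0, x 1, x 2, 0] := rfl

theorem projL_homLift (x : EuclideanSpace ℝ (Fin 3)) : projL (homLift x) = x := by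
  change !₂[homLift x 0, homLift x 1, homLift x 2] = x
  ext i
  fin_cases i <;> simp [homLift]

theorem homLift_three (x : EuclideanSpace ℝ (Fin 3)) : homLift x 3 = 1 := by
  simp [homLift]

theorem homLift_eq (x : EuclideanSpace ℝ (Fin 3)) :
    homLift x = inclL x + EuclideanSpace.single 3 1 := by
  rw [inclL_apply]
  ext i
  fin_cases i <;> simp [homLift]

theorem homLift_add_smul {a b : ℝ} (hab : a + b = 1) (x y : EuclideanSpace ℝ (Fin 3)) :
    homLift (a • x + b • y) = a • homLift x + b • homLift y := by
  obtain rfl : b = 1 - a := by linarith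
  simp only [homLift_eq, map_add, map_smul]
  module

theorem continuous_homLift : Continuous homLift := by
  have : homLift = fun x => inclL x + EuclideanSpace.single 3 1 := funext homLift_eq
  rw [this]
  fun_prop

theorem homLift_mem_coneK {x : EuclideanSpace ℝ (Fin 3)} (hx : x ∈ bodyC) : homLift x ∈ coneK :=
  PointedCone.subset_hull (mem_image_of_mem _ hx)

theorem bodyC_nonempty : bodyC.Nonempty :=
  ⟨_, arcPoint_top_mem (t := 0) ⟨le_rfl, by positivity⟩⟩

theorem mem_coneK_iff {y : EuclideanSpace ℝ (Fin 4)} :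
    y ∈ coneK ↔ ∃ t : ℝ, 0 ≤ t ∧ ∃ x ∈ bodyC, y = t • homLift x := by
  constructor
  · intro hy
    induction hy using Submodule.span_induction with
    | mem y hy =>
      obtain ⟨x, hx, rfl⟩ := hy
      exact ⟨1, zero_le_one, x, hx, (one_smul ℝ _).symm⟩
    | zero =>
      obtain ⟨x, hx⟩ := bodyC_nonempty
      exact ⟨0, le_rfl, x, hx, (zero_smul ℝ _).symm⟩
    | add y z _ _ hy hz =>
      obtain ⟨t, ht, x, hx, rfl⟩ := hy
      obtain ⟨s, hs, w, hw, rfl⟩ := hz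
      rcases (add_nonneg ht hs).eq_or_lt with h | h
      · refine ⟨0, le_rfl, x, hx, ?_⟩
        obtain rfl : t = 0 := by linarith
        obtain rfl : s = 0 := by linarith
        simp
      · have hsum : t / (t + s) + s / (t + s) = 1 := by rw [← add_div, div_self h.ne']
        refine ⟨t + s, h.le, _, convex_bodyC hx hw (div_nonneg ht h.le) (div_nonneg hs h.le) hsum,
          ?_⟩
        rw [homLift_add_smul hsum, smul_add, smul_smul, smul_smul, mul_div_cancel₀ _ h.ne',
          mul_div_cancel₀ _ h.ne']
    | smul r y _ hy =>
      obtain ⟨t, ht, x, hx, rfl⟩ := hy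
      exact ⟨r * t, mul_nonneg r.2 ht, x, hx, smul_smul (r : ℝ) t _⟩
  · rintro ⟨t, ht, x, hx, rfl⟩
    exact coneK.smul_mem ht (homLift_mem_coneK hx)

theorem isClosed_coneK : IsClosed (coneK : Set (EuclideanSpace ℝ (Fin 4))) := by
  refine IsSeqClosed.isClosed fun y z hy hz => ?_
  choose t ht x hx hyx using fun n => mem_coneK_iff.1 (hy n)
  -- the multiplier is the last coordinate, hence converges
  have htlim : Tendsto t atTop (𝓝 (z 3)) := by
    have h1 := ((EuclideanSpace.proj (𝕜 := ℝ) (3 : Fin 4)).continuous.tendsto z).comp hz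
    refine h1.congr fun n => ?_
    simp [hyx, homLift_three]
  obtain ⟨w, hw, φ, hφ, hlim⟩ := isCompact_bodyC.tendsto_subseq hx
  refine mem_coneK_iff.2 ⟨z 3, ge_of_tendsto' htlim ht, w, hw, ?_⟩
  refine tendsto_nhds_unique (hz.comp hφ.tendsto_atTop) ?_
  have h2 := (htlim.comp hφ.tendsto_atTop).smul ((continuous_homLift.tendsto w).comp hlim)
  exact h2.congr fun n => by simp [hyx]

theorem IsFace.preimage_homLift {G : Set (EuclideanSpace ℝ (Fin 4))}
    (hG : IsFace (coneK : Set (EuclideanSpace ℝ (Fin 4))) G) :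
    IsFace bodyC (bodyC ∩ homLift ⁻¹' G) := by
  refine ⟨isCompact_bodyC.isClosed.inter (hG.isClosed.preimage continuous_homLift), ?_,
    inter_subset_left, ?_⟩
  · rintro x ⟨hx, hxG⟩ y ⟨hy, hyG⟩ a b ha hb hab
    refine ⟨convex_bodyC hx hy ha hb hab, ?_⟩
    rw [mem_preimage, homLift_add_smul hab]
    exact hG.convex hxG hyG ha hb hab
  · rintro x hx y hy _ ⟨-, hwG⟩ ⟨a, b, ha, hb, hab, rfl⟩
    rw [mem_preimage, homLift_add_smul hab] at hwG
    exact ⟨hx, hG.isExtreme.left_mem_of_mem_openSegment (homLift_mem_coneK hx)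
      (homLift_mem_coneK hy) hwG ⟨a, b, ha, hb, hab, rfl⟩⟩

/-- The extension property of `bodyC` passes to its homogenization: affine functions on `ℝ³`
correspond to linear functions on `ℝ⁴`. -/
theorem faceExtension_coneK : FaceExtension (coneK : Set (EuclideanSpace ℝ (Fin 4))) := by
  intro G hG f c hf
  rcases G.eq_empty_or_nonempty with rfl | hG0
  · exact ⟨0, 0, by simp, by simp⟩
  have hc : c ≤ 0 := by simpa using hf 0 (hG.zero_mem hG0)
  -- `f` is bounded below on the cone `G`, hence nonnegative there
  have hf0 : ∀ y ∈ G, 0 ≤ f y := by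
    intro y hy
    by_contra! hneg
    have h := hf _ (hG.smul_mem hy (t := (1 - c) / -f y)
      (div_nonneg (by linarith) (by linarith)))
    rw [map_smul, smul_eq_mul, div_mul_eq_mul_div, le_div_iff₀ (by linarith)] at h
    nlinarith
  obtain ⟨g, d, hg, hgf⟩ := faceExtension_bodyC _ hG.preimage_homLift (f.comp inclL)
    (-f (EuclideanSpace.single 3 1)) (fun x hx => by
      have := hf0 _ hx.2
      rw [homLift_eq, map_add] at this
      simpa using by linarith)
  let k : StrongDual ℝ (EuclideanSpace ℝ (Fin 4)) := g.comp projL - d • EuclideanSpace.proj 3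
  have hk : ∀ x, k (homLift x) = g x - d := by
    intro x
    simp [k, projL_homLift, homLift_three]
  refine ⟨k, c, fun y hy => ?_, fun y hy => ?_⟩
  · obtain ⟨t, ht, x, hx, rfl⟩ := mem_coneK_iff.1 hy
    rw [map_smul, smul_eq_mul, hk]
    exact hc.trans (mul_nonneg ht (by linarith [hg x hx]))
  · suffices h : k y = f y by rw [h]
    obtain ⟨t, ht, x, hx, rfl⟩ := mem_coneK_iff.1 (hG.isExtreme.subset hy)
    rcases ht.eq_or_lt with rfl | ht0
    · simp
    · have hxG : homLift x ∈ G := by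
        have := hG.smul_mem hy (inv_nonneg.2 ht)
        rwa [inv_smul_smul₀ ht0.ne'] at this
      have h1 : g x - d = f (inclL x) - -f (EuclideanSpace.single 3 1) := hgf x ⟨hx, hxG⟩
      rw [map_smul, map_smul, hk, h1, homLift_eq, map_add, sub_neg_eq_add]

end Homogenization

/-! ### The tangent cones at `xBar` -/

section TangentConeAtXBar

/-- Inequalities valid on `bodyC` and tight at `xBar`. As `r` tends to `0` the supporting planes
tend to the plane `y = 1`, which touches `bodyC` along the vertical edge below `xBar`; dividing by
`r` on the face `y = 1` of the tangent cone leaves `0 ≤ x` in the limit. -/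
theorem bodyC_inequality {y : EuclideanSpace ℝ (Fin 3)} (hy : y ∈ bodyC) {r : ℝ} (hr : 0 ≤ r) :
    0 ≤ 1 - y 1 + 2 * r * y 0 + r ^ 2 * (1 - y 2) := by
  let f : StrongDual ℝ (EuclideanSpace ℝ (Fin 3)) := (2 * r) • EuclideanSpace.proj 0 -
    EuclideanSpace.proj 1 - r ^ 2 • EuclideanSpace.proj 2
  have hf : ∀ x, f x = 2 * r * x 0 - x 1 - r ^ 2 * x 2 := fun x => by simp [f]
  have h := le_on_bodyC (f := f) (c := -1 - r ^ 2) (fun t ht => ?_) (fun t ht => ?_) y hy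
  · rw [hf] at h
    linarith
  · have hcos : 0 ≤ Real.cos t :=
      Real.cos_nonneg_of_neg_pi_div_two_le_of_le (by linarith [ht.1, Real.pi_pos]) ht.2
    rw [hf]
    simp only [arcPoint, PiLp.toLp_apply, Matrix.cons_val]
    linarith [mul_nonneg hr hcos, Real.sin_le_one t]
  · rw [hf]
    simp only [arcPoint, PiLp.toLp_apply, Matrix.cons_val]
    -- `2 r² + 2 r cos t + 1 - sin t` is a sum of two squares
    linarith [sq_nonneg (2 * r + Real.cos t), sq_nonneg (1 - Real.sin t),
      Real.sin_sq_add_cos_sq t]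

theorem xBar_add_arc (u : ℝ) : xBar + (Real.sin u • !₂[1, 0, 0] + (Real.cos u - 1) • !₂[0, 1, 0]) =
    arcPoint 1 (Real.pi / 2 - u) := by
  ext i
  fin_cases i <;> simp [xBar, arcPoint, Real.cos_pi_div_two_sub, Real.sin_pi_div_two_sub]

theorem xBar_add_add_arc (u : ℝ) : xBar + !₂[0, 0, -2] +
    (Real.sin u • (-!₂[1, 0, 0]) + (Real.cos u - 1) • !₂[0, 1, 0]) =
    arcPoint (-1) (u + Real.pi / 2) := by
  ext i
  fin_cases i <;> simp [xBar, arcPoint, Real.cos_add_pi_div_two, Real.sin_add_pi_div_two]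
  norm_num

theorem xBar_add_arc_mem {u : ℝ} (hu : u ∈ Icc (0 : ℝ) 1) :
    xBar + (Real.sin u • !₂[1, 0, 0] + (Real.cos u - 1) • !₂[0, 1, 0]) ∈ bodyC := by
  rw [xBar_add_arc]
  exact arcPoint_top_mem ⟨by linarith [hu.2, Real.pi_gt_three], by linarith [hu.1]⟩

theorem xBar_add_add_arc_mem {u : ℝ} (hu : u ∈ Icc (0 : ℝ) 1) : xBar + !₂[0, 0, -2] +
    (Real.sin u • (-!₂[1, 0, 0]) + (Real.cos u - 1) • !₂[0, 1, 0]) ∈ bodyC := by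
  rw [xBar_add_add_arc]
  exact arcPoint_bottom_mem ⟨by linarith [hu.1, Real.pi_pos],
    by linarith [hu.2, Real.pi_gt_three]⟩

theorem xBar_mem_bodyC : xBar ∈ bodyC := by
  simpa using xBar_add_arc_mem (u := 0) ⟨le_rfl, zero_le_one⟩

theorem not_exposed_tangentCone_bodyC : ¬ FaciallyExposed (tangentCone bodyC xBar) ∧
    ¬ TangentiallyExposed (tangentCone bodyC xBar) := by
  refine not_exposed_tangentCone_of_arcs convex_bodyC (p := !₂[1, 0, 0]) (e := !₂[0, 1, 0])
    (q := !₂[0, 0, -2]) (-EuclideanSpace.proj 1) (EuclideanSpace.proj 0) (-EuclideanSpace.proj 2)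
    (fun y hy r hr => ?_) (fun u hu => xBar_add_arc_mem hu) (fun u hu => xBar_add_add_arc_mem hu)
    (by simp) (by simp) (by simp) (by simp)
    ⟨arcPoint 1 0, arcPoint_top_mem ⟨le_rfl, by positivity⟩, by simp [arcPoint, xBar]⟩
  have := bodyC_inequality hy hr
  simpa [xBar] using by linarith

theorem not_exposed_tangentCone_coneK :
    ¬ FaciallyExposed (tangentCone (coneK : Set (EuclideanSpace ℝ (Fin 4))) (homLift xBar)) ∧
    ¬ TangentiallyExposed
      (tangentCone (coneK : Set (EuclideanSpace ℝ (Fin 4))) (homLift xBar)) := by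
  have hlift : ∀ v : EuclideanSpace ℝ (Fin 3), homLift xBar + inclL v = homLift (xBar + v) := by
    intro v
    simp only [homLift_eq, map_add]
    abel
  refine not_exposed_tangentCone_of_arcs coneK.convex (p := inclL !₂[1, 0, 0])
    (e := inclL !₂[0, 1, 0]) (q := inclL !₂[0, 0, -2])
    (EuclideanSpace.proj 3 - EuclideanSpace.proj 1) (EuclideanSpace.proj 0)
    (EuclideanSpace.proj 3 - EuclideanSpace.proj 2)
    (fun y hy r hr => ?_) (fun u hu => ?_) (fun u hu => ?_) (by simp [inclL_apply])
    (by simp [inclL_apply]) (by simp [inclL_apply]) (by simp [inclL_apply])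
    ⟨homLift (arcPoint 1 0), homLift_mem_coneK (arcPoint_top_mem ⟨le_rfl, by positivity⟩),
      by simp [arcPoint, homLift, xBar]⟩
  · obtain ⟨t, ht, x, hx, rfl⟩ := mem_coneK_iff.1 hy
    have := mul_nonneg ht (bodyC_inequality hx hr)
    simpa [homLift, xBar] using by linarith
  · rw [← map_smul, ← map_smul, ← map_add, hlift]
    exact homLift_mem_coneK (xBar_add_arc_mem hu)
  · rw [hlift, ← map_neg, ← map_smul, ← map_smul, ← map_add, homLift_eq, add_right_comm,
      ← map_add, ← homLift_eq]
    exact homLift_mem_coneK (xBar_add_add_arc_mem hu)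

end TangentConeAtXBar

end LexTangent

end

theorem mainTheorem5 :
    -- `C` is a closed convex set and its homogenization `K` is a closed convex cone
    IsClosed LexTangent.bodyC ∧ Convex ℝ LexTangent.bodyC ∧
    IsClosed (LexTangent.coneK : Set (EuclideanSpace ℝ (Fin 4))) ∧
    -- `C` is facially and tangentially exposed
    LexTangent.FaciallyExposed LexTangent.bodyC ∧
    LexTangent.TangentiallyExposed LexTangent.bodyC ∧
    -- `K` is facially exposed, tangentially exposed and facially dual complete
    LexTangent.FaciallyExposed (LexTangent.coneK : Set (EuclideanSpace ℝ (Fin 4))) ∧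
    LexTangent.TangentiallyExposed (LexTangent.coneK : Set (EuclideanSpace ℝ (Fin 4))) ∧
    LexTangent.FaciallyDualComplete (LexTangent.coneK : Set (EuclideanSpace ℝ (Fin 4))) ∧
    -- the tangent cone of `C` at `(0,1,1)` is not facially exposed, nor tangentially exposed
    LexTangent.xBar ∈ LexTangent.bodyC ∧
    ¬ LexTangent.FaciallyExposed (LexTangent.tangentCone LexTangent.bodyC LexTangent.xBar) ∧
    ¬ LexTangent.TangentiallyExposed (LexTangent.tangentCone LexTangent.bodyC LexTangent.xBar) ∧
    -- the same for the tangent cone of `K` at the corresponding point `(0,1,1,1)`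
    LexTangent.homLift LexTangent.xBar ∈ LexTangent.coneK ∧
    ¬ LexTangent.FaciallyExposed
      (LexTangent.tangentCone (LexTangent.coneK : Set (EuclideanSpace ℝ (Fin 4)))
        (LexTangent.homLift LexTangent.xBar)) ∧
    ¬ LexTangent.TangentiallyExposed
      (LexTangent.tangentCone (LexTangent.coneK : Set (EuclideanSpace ℝ (Fin 4)))
        (LexTangent.homLift LexTangent.xBar)) ∧
    -- neither `C` nor `K` is strongly tangentially exposed
    ¬ LexTangent.StronglyTangentiallyExposed LexTangent.bodyC ∧
    ¬ LexTangent.StronglyTangentiallyExposed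
      (LexTangent.coneK : Set (EuclideanSpace ℝ (Fin 4))) ∧
    -- so strong tangential exposure is not necessary for facial dual completeness
    ¬ (∀ K : PointedCone ℝ (EuclideanSpace ℝ (Fin 4)), IsClosed (K : Set (EuclideanSpace ℝ (Fin 4))) →
      LexTangent.FaciallyDualComplete (K : Set (EuclideanSpace ℝ (Fin 4))) →
      LexTangent.StronglyTangentiallyExposed (K : Set (EuclideanSpace ℝ (Fin 4)))) := by
  have hext := LexTangent.faceExtension_bodyC
  have hextK := LexTangent.faceExtension_coneK
  have hcl := LexTangent.isCompact_bodyC.isClosed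
  have hxK := LexTangent.homLift_mem_coneK LexTangent.xBar_mem_bodyC
  have hT := LexTangent.not_exposed_tangentCone_bodyC
  have hTK := LexTangent.not_exposed_tangentCone_coneK
  have hstrong := LexTangent.not_stronglyTangentiallyExposed hxK hTK.2
  exact ⟨hcl, LexTangent.convex_bodyC, LexTangent.isClosed_coneK,
    hext.faciallyExposed LexTangent.convex_bodyC hcl, hext.tangentiallyExposed,
    hextK.faciallyExposed LexTangent.coneK.convex LexTangent.isClosed_coneK,
    hextK.tangentiallyExposed, hextK.faciallyDualComplete,
    LexTangent.xBar_mem_bodyC, hT.1, hT.2, hxK, hTK.1, hTK.2,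
    LexTangent.not_stronglyTangentiallyExposed LexTangent.xBar_mem_bodyC hT.2, hstrong,
    fun h => hstrong (h _ LexTangent.isClosed_coneK hextK.faciallyDualComplete)⟩
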